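/- Let $K$ be a field, let $V$ be a $K$-vector space, and let $\mathcal{A}=\{H_1,\ldots,H_n\}$ be a central hyperplane arrangement in $V$, i.e. a set of $n$ distinct linear hyperplanes; for each $i$ let $\alpha_i\in V^*$ be a linear form with $\ker\alpha_i=H_i$. Let $S=K[x_1,\ldots,x_n]$, $x_{[n]}=x_1\cdots x_n$, and let the relation space $F(\mathcal{A})\subseteq S_1=\bigoplus_{i=1}^n Kx_i$ be the kernel of the $K$-linear map $S_1\to V^*$, $x_i\mapsto\alpha_i$. For $f\in S$ let $\Lambda(f)$ be the least common multiple of the monomials occurring in $f$ (with $\Lambda(0)=1$), and let $\iota(f)\in S$ be the polynomial determined by $$f(x_1^{-1},\ldots,x_n^{-1})=\frac{\iota(f)(x_1,\ldots,x_n)}{\Lambda(f)(x_1,\ldots,x_n)}.$$ For a subset $\mathfrak{R}\subseteq F(\mathcal{A})$ with $K$-linear span $K\mathfrak{R}$ put $$J(\mathfrak{R})=(\iota(r)\mid r\in\mathfrak{R}),\qquad I(\mathfrak{R})=(\iota(r)\mid r\in K\mathfrak{R}),$$ ideals of $S$. **Corollary 3.3.** For every subset $\mathfrak{R}\subseteq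 F(\mathcal{A})$, $$I(\mathfrak{R})=\sqrt{J(\mathfrak{R})}:x_{[n]}=J(\mathfrak{R}):x_{[n]}.$$ Moreover, $I(\mathfrak{R})$ is the unique associated prime ideal of $J(\mathfrak{R})$ (that is, of the $S$-module $S/J(\mathfrak{R})$) that contains none of the variables $x_1,\ldots,x_n$. -/

import Mathlib

namespace OrlikTerao

/-- A central hyperplane arrangement `{H₁, …, Hₙ}` in a vector space `V` over `K`: finitely many
pairwise distinct linear hyperplanes (maximal proper subspaces) of `V`. -/
structure CentralArrangement (K V : Type*) [Field K] [AddCommGroup V] [Module K V] (n : ℕ) where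
  hyperplane : Fin n → Submodule K V
  isCoatom : ∀ i, IsCoatom (hyperplane i)
  injective : Function.Injective hyperplane

/-- `α i` is a linear form defining the `i`-th hyperplane: `ker (α i) = Hᵢ`. -/
def CentralArrangement.IsDefinedBy {K V : Type*} [Field K] [AddCommGroup V] [Module K V] {n : ℕ}
    (A : CentralArrangement K V n) (α : Fin n → Module.Dual K V) : Prop :=
  ∀ i, LinearMap.ker (α i) = A.hyperplane i

/-- The relation space `F(A)` of the arrangement with defining forms `α`: all linear forms
`∑ aᵢ xᵢ` in `S = K[x₁, …, xₙ]` such that `∑ aᵢ αᵢ = 0`, i.e. the kernel of `S₁ → V*`,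
`xᵢ ↦ αᵢ`. -/
noncomputable def relationSpace {K V : Type*} [Field K] [AddCommGroup V] [Module K V] {n : ℕ}
    (α : Fin n → Module.Dual K V) : Submodule K (MvPolynomial (Fin n) K) :=
  Submodule.map (Fintype.linearCombination K (fun i : Fin n => (MvPolynomial.X i : MvPolynomial (Fin n) K)))
    (LinearMap.ker (Fintype.linearCombination K α))

/-- The exponent vector of `Λ(f)`, the least common multiple of the monomials occurring in `f`
(the zero vector when `f = 0`, so that `Λ(0) = 1`). -/
noncomputable def lcmExponent {K : Type*} [Field K] {n : ℕ} (f : MvPolynomial (Fin n) K) :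
    Fin n →₀ ℕ :=
  f.support.sup id

/-- The polynomial `ι(f)` with `f(x₁⁻¹, …, xₙ⁻¹) = ι(f) / Λ(f)`: a term `c xᵐ` of `f`
contributes `c xˡ⁻ᵐ`, where `xˡ = Λ(f)` (the subtraction never truncates as `m ≤ l`). -/
noncomputable def iota {K : Type*} [Field K] {n : ℕ} (f : MvPolynomial (Fin n) K) :
    MvPolynomial (Fin n) K :=
  ∑ m ∈ f.support, MvPolynomial.monomial (lcmExponent f - m) (f.coeff m)

/-- `J(R) = (ι(r) | r ∈ R)`. -/
noncomputable def idealJ {K : Type*} [Field K] {n : ℕ} (R : Set (MvPolynomial (Fin n) K)) :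
    Ideal (MvPolynomial (Fin n) K) :=
  Ideal.span (iota '' R)

/-- `I(R) = (ι(r) | r ∈ KR)`, where `KR` is the `K`-linear span of `R`. -/
noncomputable def idealI {K : Type*} [Field K] {n : ℕ} (R : Set (MvPolynomial (Fin n) K)) :
    Ideal (MvPolynomial (Fin n) K) :=
  Ideal.span (iota '' (Submodule.span K R : Set (MvPolynomial (Fin n) K)))

/-- `x_[n] = x₁ ⋯ xₙ`. -/
noncomputable def prodVars (K : Type*) [Field K] (n : ℕ) : MvPolynomial (Fin n) K :=
  ∏ i, MvPolynomial.X i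

/-- The ideal `P` contains none of the variables `x₁, …, xₙ`. -/
def ContainsNoVariable {K : Type*} [Field K] {n : ℕ} (P : Ideal (MvPolynomial (Fin n) K)) : Prop :=
  ∀ i, (MvPolynomial.X i : MvPolynomial (Fin n) K) ∉ P

end OrlikTerao

/-!
Let `W` be the span of `R`, a space of linear forms containing no variable. The map
`r ↦ x_[n] r(x₁⁻¹, …, xₙ⁻¹)` is linear and agrees with `ι` up to a monomial factor dividing `x_[n]`;
hence `x_[n] I(R) ⊆ J(R)` (`mul_prodVars_mem_idealJ`). Since `J(R) ⊆ I(R)`, everything follows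
formally once `I(R)` is known to be a prime ideal containing no variable (`isPrime_span_iota`).

For this, `I(R)` is identified with the kernel of the homomorphism `xᵢ ↦ 1 / xᵢ` from `S` to the
fraction field of the domain `S / (W)`, by the argument for Orlik–Terao algebras. A monomial whose
support contains a broken circuit, with respect to the linear dependencies of the `xᵢ` modulo `W`, is
modulo `I(R)` a combination of monomials of smaller weight (`monomial_mem_sup_span`); so every
polynomial is congruent to one supported on monomials without broken circuits. The images of those
monomials in the fraction field are linearly independent (`coeff_eq_zero_of_noBrokenCircuit`): the
coefficients of the highest power of `1 / xₜ`, for the last variable `xₜ`, give a relation of the same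
kind modulo `xₜ`.
-/

namespace OrlikTerao

open MvPolynomial

variable {K : Type*} [Field K] {n : ℕ}

/-! ### Ideals generated by linear forms -/

/-- The space of linear forms `S₁ = K x₁ ⊕ ⋯ ⊕ K xₙ`. -/
noncomputable def linearForms (K : Type*) [Field K] (n : ℕ) :
    Submodule K (MvPolynomial (Fin n) K) :=
  Submodule.span K (Set.range X)

/-- For a linear projection `q` onto `W`, the endomorphism `xᵢ ↦ xᵢ - q xᵢ` kills `W` and is the
identity modulo `(W)`, so its kernel is `(W)`. -/
theorem exists_algHom_mem_span_iff {W : Submodule K (MvPolynomial (Fin n) K)}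
    (hW : W ≤ linearForms K n) :
    ∃ ψ : MvPolynomial (Fin n) K →ₐ[K] MvPolynomial (Fin n) K,
      (∀ f, f ∈ Ideal.span (W : Set (MvPolynomial (Fin n) K)) ↔ ψ f = 0) ∧
      ∀ i, X i - ψ (X i) ∈ W := by
  obtain ⟨q, hq⟩ := LinearMap.exists_leftInverse_of_injective W.subtype
    (LinearMap.ker_eq_bot.2 W.injective_subtype)
  have hq' : ∀ w (hw : w ∈ W), q w = ⟨w, hw⟩ := fun w hw =>
    LinearMap.congr_fun hq ⟨w, hw⟩
  let ψ : MvPolynomial (Fin n) K →ₐ[K] MvPolynomial (Fin n) K :=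
    aeval fun i => X i - (q (X i) : MvPolynomial (Fin n) K)
  have hψX : ∀ i, ψ (X i) = X i - (q (X i) : MvPolynomial (Fin n) K) := fun i => aeval_X _ i
  have hlin : ∀ f ∈ linearForms K n, ψ f = f - (q f : MvPolynomial (Fin n) K) := by
    intro f hf
    refine LinearMap.eqOn_span (f := ψ.toLinearMap)
      (g := LinearMap.id - W.subtype ∘ₗ q) ?_ hf
    rintro _ ⟨i, rfl⟩
    exact hψX i
  have hsub : ∀ i, X i - ψ (X i) ∈ W := fun i => by
    rw [hψX, sub_sub_cancel]; exact (q (X i)).2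
  refine ⟨ψ, fun f => ⟨fun hf => ?_, fun hf => ?_⟩, hsub⟩
  · refine (Ideal.span_le (I := RingHom.ker ψ)).2 (fun w hw => ?_) hf
    change ψ w = 0
    rw [hlin w (hW hw), hq' w hw, sub_self]
  · have h : (Ideal.Quotient.mkₐ K (Ideal.span (W : Set (MvPolynomial (Fin n) K)))).comp ψ =
        Ideal.Quotient.mkₐ K _ := by
      ext i
      exact (Ideal.Quotient.eq.2 (Ideal.subset_span (hsub i))).symm
    have h2 := AlgHom.congr_fun h f
    rw [AlgHom.comp_apply, hf, map_zero] at h2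
    exact Ideal.Quotient.eq_zero_iff_mem.1 h2.symm

theorem isPrime_span_of_le_linearForms {W : Submodule K (MvPolynomial (Fin n) K)}
    (hW : W ≤ linearForms K n) :
    (Ideal.span (W : Set (MvPolynomial (Fin n) K))).IsPrime := by
  obtain ⟨ψ, hψ, -⟩ := exists_algHom_mem_span_iff hW
  have : Ideal.span (W : Set (MvPolynomial (Fin n) K)) = RingHom.ker ψ :=
    Ideal.ext hψ
  rw [this]
  exact RingHom.ker_isPrime ψ

theorem X_mem_of_mem_span {W : Submodule K (MvPolynomial (Fin n) K)}
    (hW : W ≤ linearForms K n) {i : Fin n}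
    (hi : X i ∈ Ideal.span (W : Set (MvPolynomial (Fin n) K))) : X i ∈ W := by
  obtain ⟨ψ, hψ, hsub⟩ := exists_algHom_mem_span_iff hW
  simpa [(hψ _).1 hi] using hsub i

/-! ### Independence of the monomials without broken circuits -/

/-- The support of `m`, viewed as a set of vectors in the quotient of `S₁` by `W`, contains no
broken circuit (and in particular is independent) as far as circuits with least element `< t` are
concerned: no `xᵢ` with `i < t` is, modulo `W`, a combination of the `xⱼ` with `j` in the support
of `m` and `j > i`. -/
def NoBrokenCircuit (W : Submodule K (MvPolynomial (Fin n) K)) (t : ℕ) (m : Fin n →₀ ℕ) : Prop :=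
  ∀ i : Fin n, (i : ℕ) < t → X i ∉ W ⊔ Submodule.span K (X '' {j | m j ≠ 0 ∧ i < j})

/-- Setting `xᵢ ↦ 1 / xᵢ` in `∑ c m xᵐ` and clearing denominators by `x^N` gives the sum below, so
this says that the inverses of the monomials without broken circuits are linearly independent in
the fraction field of `S / (W)`. The last variable is split off: reducing modulo `xₜ` amounts to
contracting, i.e. to replacing `W` by `W + K xₜ`. In the process `t` decreases and the exponents of
the variables with index `≥ t` become those of `N`. -/
theorem coeff_eq_zero_of_noBrokenCircuit (t : ℕ) :
    ∀ (W : Submodule K (MvPolynomial (Fin n) K)) (_ : W ≤ linearForms K n) (N : Fin n →₀ ℕ)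
      (A : Finset (Fin n →₀ ℕ)) (c : (Fin n →₀ ℕ) → K),
      (∀ m ∈ A, m ≤ N) → (∀ m ∈ A, ∀ i : Fin n, t ≤ i → m i = N i) →
      (∀ m ∈ A, NoBrokenCircuit W t m) →
      ∑ m ∈ A, monomial (N - m) (c m) ∈ Ideal.span (W : Set (MvPolynomial (Fin n) K)) →
      ∀ m ∈ A, c m = 0 := by
  induction t with
  | zero =>
    intro W hW N A c _ hN _ hsum m hm
    have hprime := isPrime_span_of_le_linearForms hW
    have hall : ∀ m' ∈ A, m' = N := fun m' hm' => Finsupp.ext fun i => hN m' hm' i (Nat.zero_le _)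
    have hA : A = {N} := by
      ext m'
      rw [Finset.mem_singleton]
      exact ⟨hall m', fun h => by rw [h, ← hall m hm]; exact hm⟩
    rw [hA, Finset.sum_singleton, tsub_self] at hsum
    rw [hall m hm]
    by_contra hc
    refine hprime.ne_top (Ideal.eq_top_of_isUnit_mem _ hsum ?_)
    exact (IsUnit.mk0 _ hc).map (C : K →+* MvPolynomial (Fin n) K)
  | succ t ih =>
    intro W hW N A c hle hN hnbc hsum
    by_cases ht : t < n
    swap
    · exact ih W hW N A c hle (fun m hm i hi => absurd i.2 (by omega))
        (fun m hm i hi => hnbc m hm i (by omega)) hsum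
    have hprime := isPrime_span_of_le_linearForms hW
    set i₀ : Fin n := ⟨t, ht⟩ with hi₀
    have hcases : ∀ i : Fin n, t ≤ i → i = i₀ ∨ t + 1 ≤ (i : ℕ) := fun i hi => by
      rcases hi.eq_or_lt with h | h
      · exact Or.inl (Fin.ext h.symm)
      · exact Or.inr h
    obtain ⟨k, hk⟩ : ∃ k, k = N i₀ := ⟨_, rfl⟩
    induction k generalizing N A with
    | zero =>
      refine ih W hW N A c hle (fun m hm i hi => ?_)
        (fun m hm i hi => hnbc m hm i (by omega)) hsum
      rcases hcases i hi with rfl | h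
      · have := hle m hm i₀
        omega
      · exact hN m hm i h
    | succ k ihk =>
      rcases A.eq_empty_or_nonempty with rfl | ⟨m₀, hm₀⟩
      · simp
      have hX : X i₀ ∉ Ideal.span (W : Set (MvPolynomial (Fin n) K)) := fun h =>
        hnbc m₀ hm₀ i₀ (Nat.lt_succ_self t) (Submodule.mem_sup_left (X_mem_of_mem_span hW h))
      set W' := W ⊔ Submodule.span K {X i₀} with hW'
      have hW'le : W' ≤ linearForms K n :=
        sup_le hW (Submodule.span_mono (Set.singleton_subset_iff.2 ⟨i₀, rfl⟩))
      have hidealLe : Ideal.span (W : Set (MvPolynomial (Fin n) K)) ≤ Ideal.span W' :=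
        Ideal.span_mono (show W ≤ W' from le_sup_left)
      have hXW' : X i₀ ∈ Ideal.span (W' : Set (MvPolynomial (Fin n) K)) :=
        Ideal.subset_span (Submodule.mem_sup_right (Submodule.mem_span_singleton_self _))
      set e : Fin n →₀ ℕ := Finsupp.single i₀ 1 with he
      have hsmall : ∀ m ∈ A.filter (fun m => ¬ m i₀ = N i₀), m ≤ N - e := by
        intro m hm i
        rw [Finset.mem_filter] at hm
        have h1 := hle m hm.1 i
        rw [Finsupp.tsub_apply, he, Finsupp.single_apply]
        split_ifs with h
        · subst h
          have := hm.2
          omega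
        · simpa using h1
      have heN : e ≤ N := by
        rw [he, Finsupp.single_le_iff]
        omega
      have hfactor : ∑ m ∈ A.filter (fun m => ¬ m i₀ = N i₀), monomial (N - m) (c m) =
          X i₀ * ∑ m ∈ A.filter (fun m => ¬ m i₀ = N i₀), monomial (N - e - m) (c m) := by
        rw [Finset.mul_sum]
        refine Finset.sum_congr rfl fun m hm => ?_
        rw [X, monomial_mul, one_mul, ← he, ← add_tsub_assoc_of_le (hsmall m hm),
          add_tsub_cancel_of_le heN]
      have hsplit := Finset.sum_filter_add_sum_filter_not A (fun m => m i₀ = N i₀)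
        (fun m => monomial (N - m) (c m))
      rw [hfactor] at hsplit
      have hB : ∀ m ∈ A.filter (fun m => m i₀ = N i₀), c m = 0 := by
        refine ih W' hW'le N _ c (fun m hm => hle m (Finset.mem_filter.1 hm).1)
          (fun m hm i hi => ?_) (fun m hm i hi h => ?_) ?_
        · rcases hcases i hi with rfl | h
          · exact (Finset.mem_filter.1 hm).2
          · exact hN m (Finset.mem_filter.1 hm).1 i h
        · -- `xₜ` occurs in `m`, so it already lies in the span attached to `m`.
          refine hnbc m (Finset.mem_filter.1 hm).1 i (by omega) (SetLike.le_def.1 ?_ h)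
          refine sup_le (sup_le le_sup_left ?_) le_sup_right
          refine le_trans (Submodule.span_mono ?_) le_sup_right
          refine Set.singleton_subset_iff.2 ⟨i₀, ⟨?_, hi⟩, rfl⟩
          rw [(Finset.mem_filter.1 hm).2, ← hk]
          exact Nat.succ_ne_zero k
        · rw [eq_sub_of_add_eq hsplit]
          exact sub_mem (hidealLe hsum) (Ideal.mul_mem_right _ _ hXW')
      have hB0 : ∑ m ∈ A.filter (fun m => m i₀ = N i₀), monomial (N - m) (c m) = 0 :=
        Finset.sum_eq_zero fun m hm => by rw [hB m hm, monomial_zero]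
      rw [hB0, zero_add] at hsplit
      rw [← hsplit] at hsum
      have hrest := ihk (N - e) _ hsmall
        (fun m hm i hi => by
          have hne : i₀ ≠ i := fun h => by rw [← h] at hi; exact absurd hi (by simp [hi₀])
          rw [hN m (Finset.mem_filter.1 hm).1 i hi, Finsupp.tsub_apply, he,
            Finsupp.single_eq_of_ne' hne, tsub_zero])
        (fun m hm => hnbc m (Finset.mem_filter.1 hm).1)
        ((hprime.mem_or_mem hsum).resolve_left hX)
        (by rw [Finsupp.tsub_apply, he, Finsupp.single_eq_same]; omega)
      intro m hm
      by_cases h : m i₀ = N i₀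
      · exact hB m (Finset.mem_filter.2 ⟨hm, h⟩)
      · exact hrest m (Finset.mem_filter.2 ⟨hm, h⟩)

/-! ### Straightening -/

theorem exists_eq_single_of_mem_support {f : MvPolynomial (Fin n) K} (hf : f ∈ linearForms K n)
    {m : Fin n →₀ ℕ} (hm : m ∈ f.support) : ∃ i, m = Finsupp.single i 1 := by
  by_contra! h
  have : f ∈ LinearMap.ker (lcoeff K m) := by
    refine (Submodule.span_le.2 ?_ : linearForms K n ≤ _) hf
    rintro _ ⟨i, rfl⟩
    exact (coeff_X i m).trans (if_neg (h i).symm)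
  exact mem_support_iff.1 hm this

theorem le_lcmExponent {f : MvPolynomial (Fin n) K} {m : Fin n →₀ ℕ} (hm : m ∈ f.support) :
    m ≤ lcmExponent f :=
  Finset.le_sup (f := id) hm

theorem lcmExponent_le {f : MvPolynomial (Fin n) K} {N : Fin n →₀ ℕ}
    (h : ∀ m ∈ f.support, m ≤ N) : lcmExponent f ≤ N :=
  Finset.sup_le h

/-- A linear form `w` in which `xᵢ` has the least index rewrites, modulo `ι(w)`, the monomial
`Λ(w) / xᵢ` as a combination of the monomials `Λ(w) / xⱼ` with `j > i`. This lowers the weight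
`∑ j mⱼ` of every multiple of `Λ(w) / xᵢ`. -/
theorem monomial_mem_sup_span (W : Submodule K (MvPolynomial (Fin n) K))
    (I : Ideal (MvPolynomial (Fin n) K))
    (hI : ∀ w ∈ W, iota w ∈ I) (m : Fin n →₀ ℕ) :
    monomial m (1 : K) ∈ I.restrictScalars K ⊔
      Submodule.span K ((fun m => monomial m (1 : K)) '' {m | NoBrokenCircuit W n m}) := by
  set M := I.restrictScalars K ⊔
    Submodule.span K ((fun m => monomial m (1 : K)) '' {m | NoBrokenCircuit W n m}) with hM
  obtain ⟨d, hd⟩ : ∃ d, Finsupp.weight (fun i : Fin n => (i : ℕ)) m = d := ⟨_, rfl⟩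
  induction d using Nat.strong_induction_on generalizing m with
  | _ d ih =>
  by_cases hm : NoBrokenCircuit W n m
  · exact Submodule.mem_sup_right (Submodule.subset_span ⟨m, hm, rfl⟩)
  simp only [NoBrokenCircuit, not_forall, not_not] at hm
  obtain ⟨i, -, hi⟩ := hm
  obtain ⟨w, hw, s, hs, hws⟩ := Submodule.mem_sup.1 hi
  have hsupp : ∀ a ∈ s.support, ∃ j, (m j ≠ 0 ∧ i < j) ∧ a = Finsupp.single j 1 := by
    intro a ha
    by_contra! h
    have : s ∈ LinearMap.ker (lcoeff K a) := by
      refine (Submodule.span_le.2 ?_) hs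
      rintro _ ⟨j, hj, rfl⟩
      exact (coeff_X j a).trans (if_neg (h j hj).symm)
    exact mem_support_iff.1 ha this
  have hwX : w = X i - s := eq_sub_of_add_eq hws
  set e : Fin n →₀ ℕ := Finsupp.single i 1 with he
  have hse : coeff e s = 0 := by
    by_contra h
    obtain ⟨j, ⟨-, hij⟩, hj⟩ := hsupp e (mem_support_iff.2 h)
    exact hij.ne (Finsupp.single_left_injective one_ne_zero hj)
  have hwe : coeff e w = 1 := by
    rw [hwX, coeff_sub, hse, sub_zero, coeff_X, if_pos he.symm]
  have hew : e ∈ w.support := by rw [mem_support_iff, hwe]; exact one_ne_zero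
  have hwsupp : ∀ a ∈ w.support, a ≠ e → ∃ j, (m j ≠ 0 ∧ i < j) ∧ a = Finsupp.single j 1 := by
    intro a ha hae
    refine hsupp a (mem_support_iff.2 fun h => mem_support_iff.1 ha ?_)
    rw [hwX, coeff_sub, h, sub_zero, coeff_X, if_neg hae.symm]
  set l := lcmExponent w with hl
  have hl' : l ≤ m + e := by
    refine lcmExponent_le fun a ha => ?_
    by_cases hae : a = e
    · exact hae ▸ le_add_self
    · obtain ⟨j, ⟨hj, -⟩, rfl⟩ := hwsupp a ha hae
      exact (Finsupp.single_le_iff.2 (Nat.one_le_iff_ne_zero.2 hj)).trans le_self_add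
  have hlm : l - e ≤ m := tsub_le_iff_right.2 hl'
  have hiota : monomial (l - e) (1 : K) = iota w -
      ∑ a ∈ w.support.erase e, monomial (l - a) (coeff a w) := by
    rw [iota, ← Finset.add_sum_erase _ _ hew, hwe, add_sub_cancel_right]
  have hprod : monomial m (1 : K) = monomial (m - (l - e)) 1 * iota w -
      ∑ a ∈ w.support.erase e, coeff a w • monomial (m - (l - e) + (l - a)) (1 : K) := by
    rw [← Finset.sum_congr rfl fun a _ => show monomial (m - (l - e)) 1 *
      monomial (l - a) (coeff a w) = _ by rw [monomial_mul, smul_monomial, one_mul, smul_eq_mul,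
        mul_one], ← Finset.mul_sum, ← mul_sub, ← hiota, monomial_mul, one_mul,
        tsub_add_cancel_of_le hlm]
  rw [hprod]
  refine sub_mem (Submodule.mem_sup_left (I.mul_mem_left _ (hI w hw)))
    (sum_mem fun a ha => M.smul_mem _ ?_)
  rw [Finset.mem_erase] at ha
  obtain ⟨j, ⟨-, hij⟩, rfl⟩ := hwsupp a ha.2 ha.1
  have hexp : m - (l - e) + (l - Finsupp.single j 1) + Finsupp.single j 1 = m + e := by
    rw [add_assoc, tsub_add_cancel_of_le (le_lcmExponent ha.2),
      ← tsub_add_cancel_of_le (le_lcmExponent hew), ← hl, ← add_assoc,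
      tsub_add_cancel_of_le hlm]
  refine ih _ ?_ _ rfl
  have hwt := congrArg (Finsupp.weight (fun i : Fin n => (i : ℕ))) hexp
  rw [map_add, map_add _ m, Finsupp.weight_single, Finsupp.weight_single, hd] at hwt
  simp only [one_smul] at hwt
  have : (i : ℕ) < j := hij
  omega

/-! ### Primality -/

theorem aeval_inv_monomial_mul_prod_pow {L : Type*} [Field L] [Algebra K L] {y : Fin n → L}
    (hy : ∀ i, y i ≠ 0) {m N : Fin n →₀ ℕ} (h : m ≤ N) (c : K) :
    aeval (fun i => (y i)⁻¹) (monomial m c) * ∏ i, y i ^ N i =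
      aeval y (monomial (N - m) c) := by
  rw [aeval_monomial, aeval_monomial, Finsupp.prod_fintype _ _ fun i => pow_zero _,
    Finsupp.prod_fintype _ _ fun i => pow_zero _, mul_assoc, ← Finset.prod_mul_distrib]
  congr 1
  refine Finset.prod_congr rfl fun i _ => ?_
  rw [Finsupp.tsub_apply, pow_sub₀ _ (hy i) (h i), inv_pow, mul_comm]

theorem aeval_inv_iota_eq_zero {L : Type*} [Field L] [Algebra K L] {y : Fin n → L}
    (hy : ∀ i, y i ≠ 0) {f : MvPolynomial (Fin n) K} (hf : aeval y f = 0) :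
    aeval (fun i => (y i)⁻¹) (iota f) = 0 := by
  have hne : ∏ i, y i ^ lcmExponent f i ≠ 0 := Finset.prod_ne_zero_iff.2 fun i _ =>
    pow_ne_zero _ (hy i)
  refine (mul_eq_zero.1 ?_).resolve_right hne
  rw [iota, map_sum, Finset.sum_mul, ← hf]
  conv_rhs => rw [f.as_sum, map_sum]
  refine Finset.sum_congr rfl fun m hm => ?_
  rw [aeval_inv_monomial_mul_prod_pow hy tsub_le_self,
    tsub_tsub_cancel_of_le (le_lcmExponent hm)]

/-- The ideal generated by the `ι(w)`, for `w` in a space `W` of linear forms that contains no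
variable, is prime because it is the kernel of `xᵢ ↦ 1 / xᵢ` into the fraction field of `S / (W)`:
straightening leaves a representative supported on monomials without broken circuits, and these have
linearly independent images. -/
theorem isPrime_span_iota {W : Submodule K (MvPolynomial (Fin n) K)}
    (hW : W ≤ linearForms K n) (hX : ∀ i, X i ∉ W) :
    (Ideal.span (iota '' (W : Set (MvPolynomial (Fin n) K)))).IsPrime ∧
      ContainsNoVariable (Ideal.span (iota '' (W : Set (MvPolynomial (Fin n) K)))) := by
  set P := Ideal.span (W : Set (MvPolynomial (Fin n) K)) with hP
  have hprime : P.IsPrime := isPrime_span_of_le_linearForms hW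
  let y : Fin n → FractionRing (MvPolynomial (Fin n) K ⧸ P) := fun i =>
    algebraMap (MvPolynomial (Fin n) K ⧸ P) _ (Ideal.Quotient.mk P (X i))
  have hinj := FaithfulSMul.algebraMap_injective (MvPolynomial (Fin n) K ⧸ P)
    (FractionRing (MvPolynomial (Fin n) K ⧸ P))
  have hyP : ∀ f, aeval y f = 0 ↔ f ∈ P := by
    intro f
    have h : aeval y = (IsScalarTower.toAlgHom K (MvPolynomial (Fin n) K ⧸ P)
        (FractionRing (MvPolynomial (Fin n) K ⧸ P))).comp (Ideal.Quotient.mkₐ K P) := by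
      ext i
      simp [y]
    rw [h, ← Ideal.Quotient.eq_zero_iff_mem]
    exact map_eq_zero_iff _ hinj
  have hy : ∀ i, y i ≠ 0 := fun i h => by
    refine hX i (X_mem_of_mem_span hW ((hyP _).1 ?_))
    rw [aeval_X, h]
  set I := Ideal.span (iota '' (W : Set (MvPolynomial (Fin n) K))) with hI
  let φ : MvPolynomial (Fin n) K →ₐ[K] FractionRing (MvPolynomial (Fin n) K ⧸ P) :=
    aeval fun i => (y i)⁻¹
  have hIker : I ≤ RingHom.ker φ := by
    rw [hI, Ideal.span_le]
    rintro _ ⟨w, hw, rfl⟩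
    exact aeval_inv_iota_eq_zero hy ((hyP w).2 (Ideal.subset_span hw))
  suffices hker : RingHom.ker φ ≤ I by
    rw [le_antisymm hIker hker]
    refine ⟨RingHom.ker_isPrime φ, fun i hi => inv_ne_zero (hy i) ?_⟩
    rw [← aeval_X (R := K) (fun i => (y i)⁻¹) i]
    exact hi
  intro f hf
  have hfM : f ∈ I.restrictScalars K ⊔
      Submodule.span K ((fun m => monomial m (1 : K)) '' {m | NoBrokenCircuit W n m}) := by
    rw [f.as_sum]
    refine sum_mem fun m _ => ?_
    rw [← mul_one (coeff m f), ← smul_eq_mul, ← smul_monomial]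
    exact Submodule.smul_mem _ _ (monomial_mem_sup_span W I
      (fun w hw => Ideal.subset_span ⟨w, hw, rfl⟩) m)
  obtain ⟨g, hg, s, hs, rfl⟩ := Submodule.mem_sup.1 hfM
  have hsupp : ∀ a ∈ s.support, NoBrokenCircuit W n a := by
    intro a ha
    by_contra h
    have : s ∈ LinearMap.ker (lcoeff K a) := by
      refine (Submodule.span_le.2 ?_) hs
      rintro _ ⟨b, hb, rfl⟩
      refine (coeff_monomial a b 1).trans (if_neg ?_)
      rintro rfl
      exact h hb
    exact mem_support_iff.1 ha this
  have hs0 : aeval (fun i => (y i)⁻¹) s = 0 := by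
    have h : φ (g + s) = 0 := hf
    rwa [map_add, show φ g = 0 from hIker hg, zero_add] at h
  have hrev : ∑ m ∈ s.support, monomial (lcmExponent s - m) (coeff m s) ∈ P := by
    rw [← hyP, map_sum, ← zero_mul (∏ i, y i ^ lcmExponent s i), ← hs0]
    conv_rhs => enter [1]; rw [s.as_sum]
    rw [map_sum, Finset.sum_mul]
    exact Finset.sum_congr rfl fun m hm =>
      (aeval_inv_monomial_mul_prod_pow hy (le_lcmExponent hm) _).symm
  have hcoeff := coeff_eq_zero_of_noBrokenCircuit n W hW (lcmExponent s) s.support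
    (fun m => coeff m s) (fun m => le_lcmExponent) (fun m _ i hi => absurd i.2 (by omega))
    hsupp hrev
  have : s = 0 := by
    rw [s.as_sum]
    exact Finset.sum_eq_zero fun m hm => by rw [hcoeff m hm, monomial_zero]
  rw [this, add_zero]
  exact hg

/-! ### Comparison of the two ideals -/

/-- The linear map `xᵐ ↦ x_[n] / xᵐ`, for `xᵐ` dividing `x_[n]`. Where `mᵢ > 1` the exponent
truncates; on linear forms this does not occur. -/
noncomputable def complementMap (K : Type*) [Field K] (n : ℕ) :
    MvPolynomial (Fin n) K →ₗ[K] MvPolynomial (Fin n) K :=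
  (basisMonomials (Fin n) K).constr K fun m =>
    monomial (Finsupp.equivFunOnFinite.symm 1 - m) (1 : K)

theorem prodVars_eq_monomial :
    prodVars K n = monomial (Finsupp.equivFunOnFinite.symm 1) (1 : K) := by
  rw [prodVars, monomial_eq, C_1, one_mul, Finsupp.prod_fintype _ _ fun i => pow_zero _]
  simp

theorem lcmExponent_le_one {w : MvPolynomial (Fin n) K} (hw : w ∈ linearForms K n) :
    lcmExponent w ≤ Finsupp.equivFunOnFinite.symm 1 := by
  refine lcmExponent_le fun m hm => ?_
  obtain ⟨i, rfl⟩ := exists_eq_single_of_mem_support hw hm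
  rw [Finsupp.single_le_iff]
  simp

theorem complementMap_eq {w : MvPolynomial (Fin n) K} (hw : w ∈ linearForms K n) :
    complementMap K n w =
      monomial (Finsupp.equivFunOnFinite.symm 1 - lcmExponent w) 1 * iota w := by
  have h : ∀ m c, complementMap K n (monomial m c) =
      monomial (Finsupp.equivFunOnFinite.symm 1 - m) c := by
    intro m c
    have h1 : complementMap K n (monomial m 1) =
        monomial (Finsupp.equivFunOnFinite.symm 1 - m) 1 := by
      simpa only [coe_basisMonomials, complementMap] using
        (basisMonomials (Fin n) K).constr_basis K _ m
    rw [← mul_one c, ← smul_eq_mul, ← smul_monomial, map_smul, h1, smul_monomial]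
  conv_lhs => rw [w.as_sum, map_sum]
  rw [iota, Finset.mul_sum]
  refine Finset.sum_congr rfl fun m hm => ?_
  rw [h, monomial_mul, one_mul, ← add_tsub_assoc_of_le (le_lcmExponent hm),
    tsub_add_cancel_of_le (lcmExponent_le_one hw)]

/-- Unlike `ι`, the map `r ↦ x_[n] r(x₁⁻¹, …, xₙ⁻¹)` is linear, and it differs from `ι` by a monomial
factor dividing `x_[n]`. So a single factor `x_[n]` takes `I(R)` into `J(R)`. -/
theorem mul_prodVars_mem_idealJ {R : Set (MvPolynomial (Fin n) K)}
    (hR : Submodule.span K R ≤ linearForms K n) {f : MvPolynomial (Fin n) K}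
    (hf : f ∈ idealI R) : f * prodVars K n ∈ idealJ R := by
  have hle : Submodule.span K R ≤
      ((idealJ R).restrictScalars K).comap (complementMap K n) := by
    refine Submodule.span_le.2 fun r hr => ?_
    change complementMap K n r ∈ idealJ R
    rw [complementMap_eq (hR (Submodule.subset_span hr))]
    exact Ideal.mul_mem_left _ _ (Ideal.subset_span ⟨r, hr, rfl⟩)
  suffices h : idealI R ≤ (idealJ R).colon {prodVars K n} from
    Submodule.mem_colon_singleton.1 (h hf)
  refine Ideal.span_le.2 ?_
  rintro _ ⟨w, hw, rfl⟩
  refine Submodule.mem_colon_singleton.2 ?_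
  have h1 : complementMap K n w ∈ idealJ R := hle hw
  rw [complementMap_eq (hR hw)] at h1
  have h2 := Ideal.mul_mem_left (idealJ R) (monomial (lcmExponent w) 1) h1
  rwa [← mul_assoc, monomial_mul, one_mul, add_tsub_cancel_of_le (lcmExponent_le_one (hR hw)),
    ← prodVars_eq_monomial, mul_comm] at h2

theorem relationSpace_le_linearForms {V : Type*} [AddCommGroup V] [Module K V]
    (α : Fin n → Module.Dual K V) : relationSpace α ≤ linearForms K n := by
  rintro _ ⟨a, -, rfl⟩
  rw [Fintype.linearCombination_apply]
  exact sum_mem fun i _ => Submodule.smul_mem _ _ (Submodule.subset_span ⟨i, rfl⟩)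

theorem X_notMem_relationSpace {V : Type*} [AddCommGroup V] [Module K V]
    {α : Fin n → Module.Dual K V} {i : Fin n} (hi : α i ≠ 0) : X i ∉ relationSpace α := by
  rintro ⟨a, ha, hai⟩
  rw [Fintype.linearCombination_apply] at hai
  have hcoeff : a = Pi.single i 1 := by
    ext j
    have h := congrArg (coeff (Finsupp.single j 1)) hai
    simp only [coeff_sum, coeff_smul, coeff_X, Finsupp.single_left_inj one_ne_zero] at h
    simpa [Pi.single_apply, eq_comm] using h
  rw [hcoeff, SetLike.mem_coe, LinearMap.mem_ker, Fintype.linearCombination_apply_single,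
    one_smul] at ha
  exact hi ha

end OrlikTerao

theorem corollary3p3 {K V : Type*} [Field K] [AddCommGroup V] [Module K V] {n : ℕ}
    (A : OrlikTerao.CentralArrangement K V n)
    (α : Fin n → Module.Dual K V) (hα : A.IsDefinedBy α)
    (R : Set (MvPolynomial (Fin n) K))
    (hR : R ⊆ (OrlikTerao.relationSpace α : Set (MvPolynomial (Fin n) K))) :
    OrlikTerao.idealI R =
        Submodule.colon (OrlikTerao.idealJ R).radical {OrlikTerao.prodVars K n} ∧
    OrlikTerao.idealI R =
        Submodule.colon (OrlikTerao.idealJ R) {OrlikTerao.prodVars K n} ∧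
    (OrlikTerao.idealI R ∈ associatedPrimes (MvPolynomial (Fin n) K)
          (MvPolynomial (Fin n) K ⧸ OrlikTerao.idealJ R) ∧
      OrlikTerao.ContainsNoVariable (OrlikTerao.idealI R)) ∧
    ∀ P ∈ associatedPrimes (MvPolynomial (Fin n) K)
        (MvPolynomial (Fin n) K ⧸ OrlikTerao.idealJ R),
      OrlikTerao.ContainsNoVariable P → P = OrlikTerao.idealI R := by
  open OrlikTerao in
  have hspan : Submodule.span K R ≤ relationSpace α := Submodule.span_le.2 hR
  have hlin := hspan.trans (relationSpace_le_linearForms α)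
  have hα0 : ∀ i, α i ≠ 0 := fun i h => by
    refine (A.isCoatom i).1 ?_
    rw [← hα i, h, LinearMap.ker_zero]
  obtain ⟨hprime, hnoVar⟩ :
      (idealI R).IsPrime ∧ ContainsNoVariable (idealI R) :=
    isPrime_span_iota hlin fun i hi => X_notMem_relationSpace (hα0 i) (hspan hi)
  have hprodVars : ∀ {P : Ideal (MvPolynomial (Fin n) K)}, P.IsPrime → ContainsNoVariable P →
      prodVars K n ∉ P := fun hP hX h => by
    obtain ⟨i, -, hi⟩ := hP.prod_mem_iff.1 h
    exact hX i hi
  have hJI : idealJ R ≤ idealI R := Ideal.span_mono (Set.image_mono Submodule.subset_span)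
  have hIJ : idealI R ≤ (idealJ R).colon {prodVars K n} := fun f hf =>
    Submodule.mem_colon_singleton.2 (mul_prodVars_mem_idealJ hlin hf)
  have hmono : (idealJ R).colon {prodVars K n} ≤ (idealJ R).radical.colon {prodVars K n} :=
    Submodule.colon_mono Ideal.le_radical subset_rfl
  have hradI : (idealJ R).radical.colon {prodVars K n} ≤ idealI R := fun f hf =>
    (hprime.mem_or_mem
      (hprime.radical_le_iff.2 hJI (Submodule.mem_colon_singleton.1 hf))).resolve_right
      (hprodVars hprime hnoVar)
  have hcolon := le_antisymm hIJ (hmono.trans hradI)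
  have hann : ∀ f g : MvPolynomial (Fin n) K,
      g ∈ (⊥ : Submodule (MvPolynomial (Fin n) K) (MvPolynomial (Fin n) K ⧸ idealJ R)).colon
        {Ideal.Quotient.mk (idealJ R) f} ↔ g * f ∈ idealJ R := fun f g => by
    rw [Submodule.mem_colon_singleton, Submodule.mem_bot, ← Ideal.Quotient.eq_zero_iff_mem]
    rfl
  refine ⟨le_antisymm (hIJ.trans hmono) hradI, hcolon, ⟨?_, hnoVar⟩, fun P hP hPX => ?_⟩
  · refine AssociatedPrimes.mem_iff.2 (isAssociatedPrime_iff.2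
      ⟨hprime, Ideal.Quotient.mk _ (prodVars K n), ?_⟩)
    ext g
    rw [hann, hcolon]
    exact Submodule.mem_colon_singleton
  · obtain ⟨hPprime, x, hx⟩ := isAssociatedPrime_iff.1 (AssociatedPrimes.mem_iff.1 hP)
    obtain ⟨f, rfl⟩ := Ideal.Quotient.mk_surjective x
    have hmem : ∀ g, g ∈ P ↔ g * f ∈ idealJ R := fun g => by rw [hx, hann]
    have hprodP := hprodVars hPprime hPX
    have hf : f ∉ idealI R := fun h => hprodP <| (hmem _).2 <| by
      rw [mul_comm]
      exact mul_prodVars_mem_idealJ hlin h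
    refine le_antisymm (fun g hg => ?_) fun g hg => ?_
    · exact (hprime.mem_or_mem (hJI ((hmem g).1 hg))).resolve_right hf
    · refine (hPprime.mem_or_mem ((hmem (g * prodVars K n)).2 ?_)).resolve_right hprodP
      exact Ideal.mul_mem_right _ _ (mul_prodVars_mem_idealJ hlin hg)
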